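/- All lattices are nonempty. For a lattice $L$, $\operatorname{Con} L$ is the lattice of congruences of $L$ ordered by inclusion, $J(L)$ is the poset of nonzero join-irreducible elements of $L$, and $M(L)$ is the poset of non-unit meet-irreducible elements of $L$. A \emph{slim semimodular lattice} is a finite (upper) semimodular lattice $L$ such that $J(L)$ is the union of two (possibly empty) chains. A \emph{slim rectangular lattice} is a slim semimodular lattice $L$ such that $J(L)\cap M(L)$ consists of exactly two elements and these two elements are complementary (their meet is $0$ and their join is $1$). A finite distributive lattice $D$ is \emph{CSPS-representable} (respectively, \emph{CSR-representable}) if $D\cong\operatorname{Con} L$ for some slim semimodular (respectively, slim rectangular) lattice $L$. A finite, possibly empty poset $P$ is \emph{JCSPS-representable} (respectively, \emph{JCSR-representable}) if $P\cong J(\operatorname{Con} L)$ for some slim semimodular (respectively, slim rectangular) lattice $L$. Lattice filters are nonempty; an order filter of a poset is a (possibly empty) up-set with the inherited order. (A) Let $D$ be a CSPS-representable finite distributive lattice. Then every filter of $D$ (regarded as a lattice) is CSPS-representable, and every filter of $D$ with at least three elements is CSR-representable. (B) Let $P$ be a finite, possibly empty poset. If $P$ is JCSPS-representable, then every order filter of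 $P$ is JCSPS-representable, and every order filter of $P$ with at least two elements is JCSR-representable. In particular, if $P$ is JCSR-representable, then every order filter of $P$ with at least two elements is JCSR-representable. -/

import Mathlib

/-! ### Congruence lattices -/

namespace LatticeCon

variable {L : Type*} [Lattice L]

theorem toSetoid_inj : Function.Injective (toSetoid : LatticeCon L → Setoid L) := by
  rintro ⟨s, hs, hs'⟩ ⟨t, ht, ht'⟩ h
  obtain rfl : s = t := h
  rfl

/-- Congruences are ordered by inclusion: `c ≤ d` iff `c.r x y` implies `d.r x y`. -/
instance instPartialOrder : PartialOrder (LatticeCon L) :=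
  PartialOrder.lift toSetoid toSetoid_inj

theorem le_iff {c d : LatticeCon L} : c ≤ d ↔ ∀ ⦃x y : L⦄, c.r x y → d.r x y :=
  Iff.rfl

/-- The infimum of a set of congruences is their intersection. -/
instance instInfSet : InfSet (LatticeCon L) where
  sInf S :=
    { r := fun x y => ∀ c ∈ S, c.r x y
      iseqv :=
        { refl := fun x c _ => c.iseqv.refl x
          symm := fun h c hc => c.iseqv.symm (h c hc)
          trans := fun h h' c hc => c.iseqv.trans (h c hc) (h' c hc) }
      inf := fun h h' c hc => c.inf (h c hc) (h' c hc)
      sup := fun h h' c hc => c.sup (h c hc) (h' c hc) }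

/-- The congruence lattice `Con L` of a lattice `L`, ordered by inclusion. -/
instance instCompleteLattice : CompleteLattice (LatticeCon L) :=
  completeLatticeOfInf _ fun _ =>
    ⟨fun c hc _ _ h => h c hc, fun _ hd _ _ h _ hc => hd hc h⟩

end LatticeCon

/-! ### Filters of a distributive lattice as lattices -/

/-- A filter of a distributive lattice is a distributive lattice under the inherited operations. -/
instance Order.PFilter.instDistribLattice {D : Type*} [DistribLattice D] (F : Order.PFilter D) :
    DistribLattice F :=
  Subtype.distribLattice (P := fun x => x ∈ F)
    (fun _ _ hx _ => Order.PFilter.mem_of_le le_sup_left hx)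
    (fun _ _ hx hy => Order.PFilter.inf_mem hx hy)

/-! ### Slim semimodular and slim rectangular lattices -/

/-- The poset `J(L)` of nonzero join-irreducible elements of `L`, with the order inherited from `L`
(`SupIrred` excludes minimal elements). -/
abbrev JirPoset (L : Type*) [Lattice L] : Type _ := {x : L // SupIrred x}

/-- A slim lattice: a finite (nonempty) lattice whose set of nonzero join-irreducible elements is
the union of two (possibly empty) chains. -/
structure IsSlimLattice (L : Type*) [Lattice L] : Prop where
  finite : Finite L
  nonempty : Nonempty L
  jir_eq_union : ∃ C C' : Set L,
    IsChain (· ≤ ·) C ∧ IsChain (· ≤ ·) C' ∧ {x : L | SupIrred x} = C ∪ C'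

/-- A slim semimodular lattice. Mathlib's `IsUpperModularLattice` is (upper) semimodularity:
`a ⊓ b ⋖ a` implies `b ⋖ a ⊔ b`. -/
structure IsSlimSemimodularLattice (L : Type*) [Lattice L] : Prop extends IsSlimLattice L where
  semimodular : IsUpperModularLattice L

/-- A doubly irreducible element: nonzero join-irreducible and non-unit meet-irreducible. -/
def IsDoublyIrred {L : Type*} [Lattice L] (x : L) : Prop :=
  SupIrred x ∧ InfIrred x

/-- A slim rectangular lattice: a slim semimodular lattice that has exactly two doubly irreducible
elements, and these two elements are complementary (their meet is `0` and their join is `1`). -/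
structure IsSlimRectangularLattice (L : Type*) [Lattice L] : Prop
    extends IsSlimSemimodularLattice L where
  exists_corners : ∃ a b : L, a ≠ b ∧ (∀ x : L, IsDoublyIrred x ↔ x = a ∨ x = b) ∧
    IsBot (a ⊓ b) ∧ IsTop (a ⊔ b)

/-! ### Representability

As slim lattices are finite, letting `L` range over lattices in `Type` loses no generality. An order
isomorphism between lattices is the same as a lattice isomorphism. -/

/-- `D` is CSPS-representable: `D ≅ Con L` for some slim semimodular lattice `L`. -/
def CSPSRepresentable (D : Type*) [DistribLattice D] : Prop :=
  ∃ (L : Type) (_ : Lattice L), IsSlimSemimodularLattice L ∧ Nonempty (D ≃o LatticeCon L)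

/-- `D` is CSR-representable: `D ≅ Con L` for some slim rectangular lattice `L`. -/
def CSRRepresentable (D : Type*) [DistribLattice D] : Prop :=
  ∃ (L : Type) (_ : Lattice L), IsSlimRectangularLattice L ∧ Nonempty (D ≃o LatticeCon L)

/-- `P` is JCSPS-representable: `P ≅ J(Con L)` for some slim semimodular lattice `L`. -/
def JCSPSRepresentable (P : Type*) [PartialOrder P] : Prop :=
  ∃ (L : Type) (_ : Lattice L), IsSlimSemimodularLattice L ∧
    Nonempty (P ≃o JirPoset (LatticeCon L))

/-- `P` is JCSR-representable: `P ≅ J(Con L)` for some slim rectangular lattice `L`. -/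
def JCSRRepresentable (P : Type*) [PartialOrder P] : Prop :=
  ∃ (L : Type) (_ : Lattice L), IsSlimRectangularLattice L ∧
    Nonempty (P ≃o JirPoset (LatticeCon L))

/-!
A slim semimodular lattice is determined by its meet-irreducible elements, placed in the plane by
their positions relative to two maximal chains that cover the join-irreducible elements: `a`
corresponds to the set of meet-irreducibles above `a`, and the sets that arise are exactly the
quadrants `{e | s ≤ x e ∧ t ≤ y e}`. Conversely, every finite planar configuration of points has a
slim semimodular lattice of quadrants.

In the plane, a congruence is the set of points `e` for which it identifies the quadrant of `e`
with that quadrant minus `e`. The sets that occur are those closed under a forcing relation: a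
point that has other points both to its upper left and to its lower right is forced by the
rightmost of the former and by the topmost of the latter. A filter of the congruence lattice is the
up-set of one closed set `T`, hence the lattice of closed sets of the configuration with `T`
removed, in which forcing is unchanged because a point outside `T` is forced only by points outside
`T`. Finally, a point with no point to its upper left, or none to its lower right, is not forced at
all, so such points can be pushed beyond all other points without affecting forcing, and this makes
the quadrant lattice rectangular.

Statement (B) is (A) for the distributive lattice of lower sets of `P`.
-/

/-! ### Congruences and isomorphisms -/

section LatticeConCongr

variable {L L' : Type*} [Lattice L] [Lattice L']

/-- The preimage of a congruence under a lattice isomorphism. -/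
def latticeConComap (f : L ≃o L') (θ : LatticeCon L') : LatticeCon L where
  r x y := θ.r (f x) (f y)
  iseqv := θ.iseqv.comap f
  inf h h' := by simpa only [map_inf] using θ.inf h h'
  sup h h' := by simpa only [map_sup] using θ.sup h h'

theorem latticeConComap_le_iff (f : L ≃o L') {θ θ' : LatticeCon L'} :
    latticeConComap f θ ≤ latticeConComap f θ' ↔ θ ≤ θ' := by
  refine ⟨fun h x y hxy => ?_, fun h _ _ hxy => h hxy⟩
  obtain ⟨x, rfl⟩ := f.surjective x
  obtain ⟨y, rfl⟩ := f.surjective y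
  exact h hxy

theorem latticeConComap_symm_comap (f : L ≃o L') (θ : LatticeCon L) :
    latticeConComap f (latticeConComap f.symm θ) = θ := by
  refine LatticeCon.toSetoid_inj (Setoid.ext fun x y => ?_)
  change θ.r (f.symm (f x)) (f.symm (f y)) ↔ θ.r x y
  rw [f.symm_apply_apply, f.symm_apply_apply]

/-- Isomorphic lattices have isomorphic congruence lattices. -/
def latticeConCongr (f : L ≃o L') : LatticeCon L ≃o LatticeCon L' where
  toFun := latticeConComap f.symm
  invFun := latticeConComap f
  left_inv := latticeConComap_symm_comap f
  right_inv := latticeConComap_symm_comap f.symm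
  map_rel_iff' := latticeConComap_le_iff f.symm

end LatticeConCongr

theorem supIrred_orderIso_apply {L L' : Type*} [Lattice L] [Lattice L'] (f : L ≃o L') {a : L} :
    SupIrred (f a) ↔ SupIrred a := by
  refine and_congr (not_congr f.isMin_apply) ⟨fun h b c hbc => ?_, fun h b c hbc => ?_⟩
  · exact (h (by rw [← map_sup, hbc])).imp (fun h => f.injective h) fun h => f.injective h
  · rw [← f.symm_apply_eq, ← f.symm_apply_eq]
    exact h (by rw [← map_sup, hbc, f.symm_apply_apply])
/-- The lattice of the sets that are closed under a relation, ordered by inclusion. -/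
def closedSets {E : Type*} (R : E → E → Prop) : Sublattice (Set E) where
  carrier := {T | ∀ ⦃e t⦄, R e t → e ∈ T → t ∈ T}
  supClosed' _ hS _ hT _ _ h := Or.imp (hS h) (hT h)
  infClosed' _ hS _ hT _ _ h := And.imp (hS h) (hT h)

section PlanarConfigurations

variable {E α β : Type*} [LinearOrder α] [LinearOrder β]

/-- A planar point configuration: each point is determined by either of its two coordinates. -/
structure PlanarConfig (E α β : Type*) where
  /-- The first coordinate. -/
  x : E → α
  /-- The second coordinate. -/
  y : E → β
  x_injective : Function.Injective x
  y_injective : Function.Injective y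

namespace PlanarConfig

/-- The reflected configuration, in which left/right and below/above change places. -/
def swap (c : PlanarConfig E α β) : PlanarConfig E β α where
  x := c.y
  y := c.x
  x_injective := c.y_injective
  y_injective := c.x_injective

variable (c : PlanarConfig E α β)

/-- A quadrant: a set of points cut out by a lower bound for the first coordinate and a lower bound
for the second one. The closure axiom avoids naming the bounds. -/
@[ext]
structure Quadrant where
  /-- The points of the quadrant. -/
  carrier : Set E
  mem_of_le' : ∀ ⦃p q e⦄, p ∈ carrier → q ∈ carrier → c.x p ≤ c.x e → c.y q ≤ c.y e → e ∈ carrier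

variable {c}

namespace Quadrant

instance : SetLike c.Quadrant E where
  coe := carrier
  coe_injective _ _ := Quadrant.ext

theorem mem_of_le (u : c.Quadrant) {p q e : E} (hp : p ∈ u) (hq : q ∈ u) (hx : c.x p ≤ c.x e)
    (hy : c.y q ≤ c.y e) : e ∈ u :=
  u.mem_of_le' hp hq hx hy

end Quadrant

variable (c)

/-- The quadrant `(s × t) ∩ E`; `⊥ : UpperSet α` imposes no bound. -/
def rect (s : UpperSet α) (t : UpperSet β) : c.Quadrant where
  carrier := {e | c.x e ∈ s ∧ c.y e ∈ t}
  mem_of_le' _ _ _ hp hq hx hy := ⟨s.upper hx hp.1, t.upper hy hq.2⟩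

/-- The least quadrant that contains `S`. -/
def hull (S : Set E) : c.Quadrant where
  carrier := {e | (∃ p ∈ S, c.x p ≤ c.x e) ∧ ∃ q ∈ S, c.y q ≤ c.y e}
  mem_of_le' := by
    rintro _ _ _ ⟨⟨p, hp, hp'⟩, -⟩ ⟨-, q, hq, hq'⟩ hx hy
    exact ⟨⟨p, hp, hp'.trans hx⟩, q, hq, hq'.trans hy⟩

/-- The closed quadrant with apex `e`. -/
def quad (e : E) : c.Quadrant := c.rect (.Ici (c.x e)) (.Ici (c.y e))

/-- The open quadrant with apex `e`. -/
def openQuad (e : E) : c.Quadrant := c.rect (.Ioi (c.x e)) (.Ioi (c.y e))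

variable {c} {e f : E} {S : Set E}

theorem subset_hull (S : Set E) : S ⊆ c.hull S :=
  fun e he => ⟨⟨e, he, le_rfl⟩, e, he, le_rfl⟩

namespace Quadrant

theorem hull_subset_iff {u : c.Quadrant} : (c.hull S : Set E) ⊆ u ↔ S ⊆ u :=
  ⟨(subset_hull S).trans, fun h _ ⟨⟨_, hp, hp'⟩, _, hq, hq'⟩ => u.mem_of_le (h hp) (h hq) hp' hq'⟩

/-- The lattice of quadrants, ordered by reverse inclusion. -/
instance instLattice : Lattice c.Quadrant where
  le u v := (v : Set E) ⊆ u
  le_refl _ := Set.Subset.rfl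
  le_trans _ _ _ h h' := Set.Subset.trans h' h
  le_antisymm _ _ h h' := SetLike.coe_injective (Set.Subset.antisymm h' h)
  sup u v :=
    { carrier := u ∩ v
      mem_of_le' := fun _ _ _ hp hq hx hy =>
        ⟨u.mem_of_le hp.1 hq.1 hx hy, v.mem_of_le hp.2 hq.2 hx hy⟩ }
  le_sup_left _ _ := Set.inter_subset_left
  le_sup_right _ _ := Set.inter_subset_right
  sup_le _ _ _ := Set.subset_inter
  inf u v := c.hull (u ∪ v)
  inf_le_left _ _ := Set.subset_union_left.trans (subset_hull _)
  inf_le_right _ _ := Set.subset_union_right.trans (subset_hull _)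
  le_inf _ _ _ h h' := hull_subset_iff.2 (Set.union_subset h h')

instance [Finite E] : Finite c.Quadrant := Finite.of_injective _ SetLike.coe_injective

variable {u v w : c.Quadrant}

theorem le_iff : u ≤ v ↔ (v : Set E) ⊆ u := Iff.rfl

theorem lt_iff : u < v ↔ (v : Set E) ⊂ u := Iff.rfl

theorem le_hull_iff : u ≤ c.hull S ↔ S ⊆ u := hull_subset_iff

theorem le_quad_iff : u ≤ c.quad e ↔ e ∈ u :=
  ⟨fun h => h ⟨le_rfl, le_rfl⟩, fun h _ hf => u.mem_of_le h h hf.1 hf.2⟩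

theorem quad_le_openQuad (e : E) : c.quad e ≤ c.openQuad e :=
  fun _ hf => ⟨hf.1.le, hf.2.le⟩

theorem mem_openQuad_of_mem_quad (h : f ∈ c.quad e) (hne : f ≠ e) : f ∈ c.openQuad e :=
  ⟨h.1.lt_of_ne (c.x_injective.ne hne.symm), h.2.lt_of_ne (c.y_injective.ne hne.symm)⟩

/-- Reflection of quadrants. -/
def swapOrderIso : c.Quadrant ≃o c.swap.Quadrant where
  toFun u := ⟨u, fun _ _ _ hp hq hx hy => u.mem_of_le hq hp hy hx⟩
  invFun u := ⟨u, fun _ _ _ hp hq hx hy => u.mem_of_le hq hp hy hx⟩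
  left_inv _ := rfl
  right_inv _ := rfl
  map_rel_iff' := Iff.rfl

/-! ### Covers -/

theorem anti_exchange_of_forall_lt (hne : f ≠ e) (hf : f ∈ c.hull (insert e v))
    (hv : ∀ r ∈ v, c.x f < c.x r) : e ∉ c.hull (insert f v) := by
  obtain ⟨⟨p, rfl | hp, hpf⟩, -⟩ := hf
  · rintro ⟨⟨s, rfl | hs, hse⟩, -⟩
    · exact hne (c.x_injective (hse.antisymm hpf))
    · exact ((hv s hs).trans_le hse).not_ge hpf
  · exact absurd hpf (hv p hp).not_ge

theorem anti_exchange (hfv : f ∉ v) (hne : f ≠ e) (hf : f ∈ c.hull (insert e v)) :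
    e ∉ c.hull (insert f v) := by
  obtain hv | hv : (∀ r ∈ v, c.x f < c.x r) ∨ ∀ r ∈ v, c.y f < c.y r := by
    by_contra! h
    obtain ⟨⟨r, hr, hrf⟩, s, hs, hsf⟩ := h
    exact hfv (v.mem_of_le hr hs hrf hsf)
  · exact anti_exchange_of_forall_lt hne hf hv
  · have := anti_exchange_of_forall_lt (c := c.swap) (v := swapOrderIso v) hne hf.symm hv
    exact fun h => this h.symm

theorem coe_eq_insert_of_covBy (h : u ⋖ v) : ∃ e ∉ v, (u : Set E) = insert e ↑v := by
  have hull_insert_eq {e : E} (heu : e ∈ u) (hev : e ∉ v) : c.hull (insert e v) = u := by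
    have hle : u ≤ c.hull (insert e v) := le_hull_iff.2 (Set.insert_subset heu h.le)
    have hlt : c.hull (insert e v) < v :=
      ((Set.ssubset_insert hev).trans_subset (subset_hull _) : (v : Set E) ⊂ _)
    exact (hle.eq_of_not_lt fun hlt' => h.2 hlt' hlt).symm
  obtain ⟨e, heu, hev⟩ := Set.exists_of_ssubset (lt_iff.1 h.lt)
  refine ⟨e, hev, (Set.insert_subset heu h.le).antisymm' fun f hfu => ?_⟩
  by_contra! hf
  obtain ⟨hne, hfv⟩ : f ≠ e ∧ f ∉ v := not_or.1 hf
  apply anti_exchange hfv hne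
  · rwa [hull_insert_eq heu hev]
  · rwa [hull_insert_eq hfu hfv]

theorem covBy_iff : u ⋖ v ↔ ∃ e ∉ v, (u : Set E) = insert e ↑v := by
  refine ⟨coe_eq_insert_of_covBy, fun ⟨e, hev, hu⟩ => ⟨?_, fun w huw hwv => ?_⟩⟩
  · exact lt_iff.2 (hu ▸ Set.ssubset_insert hev)
  · have := lt_iff.1 huw
    rw [hu] at this
    exact (Set.covBy_insert hev).2 (lt_iff.1 hwv) this

end Quadrant

/-! ### Congruences -/

section Congruence

variable {u v : c.Quadrant}

namespace Quadrant

/-- The points `e` for which the congruence collapses the prime interval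
`[c.quad e, c.openQuad e]`. -/
def collapsed (θ : LatticeCon c.Quadrant) : Set E :=
  {e | θ.r (c.quad e) (c.openQuad e)}

variable {θ : LatticeCon c.Quadrant}

theorem mem_collapsed_of_rel (h : θ.r u v) (heu : e ∈ u) (hev : e ∉ v) : e ∈ collapsed θ := by
  have quad_rel : θ.r (c.quad e) (v ⊔ c.quad e) := by
    simpa only [sup_eq_right.2 (le_quad_iff.2 heu)] using θ.sup h (θ.iseqv.refl (c.quad e))
  have openQuad_le : c.openQuad e ≤ v ⊔ c.quad e :=
    fun f hf => mem_openQuad_of_mem_quad hf.2 fun hfe => hev (hfe ▸ hf.1)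
  have openQuad_rel : θ.r (c.openQuad e) (v ⊔ c.quad e) := by
    simpa only [sup_eq_right.2 (quad_le_openQuad e), sup_eq_left.2 openQuad_le]
      using θ.sup quad_rel (θ.iseqv.refl (c.openQuad e))
  exact θ.iseqv.trans quad_rel (θ.iseqv.symm openQuad_rel)

theorem rel_of_coe_eq_insert (hu : (u : Set E) = insert e ↑v)
    (he : e ∈ collapsed θ) : θ.r u v := by
  have inf_quad : v ⊓ c.quad e = u := by
    have huv : u ≤ v := le_iff.2 (hu ▸ Set.subset_insert e _)
    have heu : e ∈ u := hu.ge (Set.mem_insert e _)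
    refine le_antisymm (le_iff.2 (hu ▸ Set.insert_subset ?_ ?_)) (le_inf huv (le_quad_iff.2 heu))
    · exact le_quad_iff.1 inf_le_right
    · exact le_iff.1 inf_le_left
  have inf_openQuad : v ⊓ c.openQuad e = v := by
    refine inf_eq_left.2 fun f hf => ?_
    have hfu : f ∈ u := le_quad_iff.2 (hu.ge (Set.mem_insert e _)) ⟨hf.1.le, hf.2.le⟩
    exact (hu.le hfu).resolve_left fun hfe => hf.1.ne (hfe ▸ rfl)
  simpa only [inf_quad, inf_openQuad] using θ.inf (θ.iseqv.refl v) he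

theorem rel_of_diff_subset_collapsed [Finite E] (huv : u ≤ v)
    (h : (u : Set E) \ v ⊆ collapsed θ) : θ.r u v := by
  induction v using WellFoundedLT.induction with
  | ind v ih =>
    obtain rfl | hlt := huv.eq_or_lt
    · exact θ.iseqv.refl u
    obtain ⟨w, huw, hwv⟩ := exists_le_covBy_of_lt hlt
    obtain ⟨e, hev, hw⟩ := covBy_iff.1 hwv
    have heu : e ∈ u := huw (hw.ge (Set.mem_insert e _))
    have hle : (v : Set E) ⊆ w := hwv.le
    exact θ.iseqv.trans (ih w hwv.lt huw ((Set.sdiff_subset_sdiff_right hle).trans h))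
      (rel_of_coe_eq_insert hw (h ⟨heu, hev⟩))

theorem rel_iff [Finite E] : θ.r u v ↔ ∀ e ∉ collapsed θ, e ∈ u ↔ e ∈ v := by
  refine ⟨fun h e he => ⟨?_, ?_⟩, fun h => ?_⟩
  · exact fun heu => by_contra fun hev => he (mem_collapsed_of_rel h heu hev)
  · exact fun hev => by_contra fun heu => he (mem_collapsed_of_rel (θ.iseqv.symm h) hev heu)
  · have rel_left : θ.r u (u ⊔ v) := rel_of_diff_subset_collapsed le_sup_left fun e he =>
      by_contra fun hec => he.2 ⟨he.1, (h e hec).1 he.1⟩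
    have rel_right : θ.r v (u ⊔ v) := rel_of_diff_subset_collapsed le_sup_right fun e he =>
      by_contra fun hec => he.2 ⟨(h e hec).2 he.1, he.1⟩
    exact θ.iseqv.trans rel_left (θ.iseqv.symm rel_right)

end Quadrant

end Congruence

/-! ### Forcing -/

section Forcing

variable {p s t : E}

/-- `p` lies to the upper left of `t`. -/
def UpperLeft (c : PlanarConfig E α β) (p t : E) : Prop := c.x p < c.x t ∧ c.y t < c.y p

/-- Among the points to the upper left of `t`, the rightmost one is `e`, and `t` has a point to its
lower right. -/
def LeftForces (c : PlanarConfig E α β) (e t : E) : Prop :=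
  c.UpperLeft e t ∧ (∀ f, c.UpperLeft f t → c.x f ≤ c.x e) ∧ ∃ s, c.UpperLeft t s

/-- The relation that generates the order of the join-irreducible congruences of the quadrant
lattice: a congruence that collapses `e` collapses `t`. -/
def Forces (c : PlanarConfig E α β) (e t : E) : Prop := c.LeftForces e t ∨ c.swap.LeftForces e t

theorem upperLeft_swap : c.swap.UpperLeft p t ↔ c.UpperLeft t p := and_comm

theorem UpperLeft.trans (h : c.UpperLeft p t) (h' : c.UpperLeft t s) : c.UpperLeft p s :=
  ⟨h.1.trans h'.1, h'.2.trans h.2⟩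

theorem exists_leftForces [Finite E] (hp : c.UpperLeft p t) (hs : c.UpperLeft t s) :
    ∃ e, c.LeftForces e t ∧ c.x p ≤ c.x e := by
  obtain ⟨e, he, hmax⟩ := Set.exists_max_image {e | c.UpperLeft e t} c.x (Set.toFinite _) ⟨p, hp⟩
  exact ⟨e, ⟨he, hmax, s, hs⟩, hmax p hp⟩

end Forcing

section CongruencesAndClosedSets

variable {t : E} {T : Set E} {u v w z : c.Quadrant}

namespace Quadrant

/-- A witness `p ∈ u` for `f ∈ c.hull (u ∪ S)` that is not in `S` lies to the upper left of `f`, so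
the point left-forcing `f` is a point of the same hull further to the left. -/
theorem exists_x_le_of_mem_hull_union [Finite E]
    (hT : ∀ ⦃e t⦄, c.LeftForces e t → e ∈ T → t ∈ T) (hu : (u : Set E) \ T ⊆ S) (hfT : f ∉ T)
    (hf : f ∈ c.hull (u ∪ S)) : ∃ s ∈ S, c.x s ≤ c.x f := by
  induction f using (Finite.wellFounded_of_trans_of_irrefl (InvImage (· < ·) c.x)).induction with
  | h f ih =>
    by_contra! hS
    obtain ⟨⟨p, hp, hpf⟩, q, hq, hqf⟩ := hf
    have hfu : f ∉ u := fun h => (hS f (hu ⟨h, hfT⟩)).false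
    have hfS : f ∉ S := fun h => (hS f h).false
    have hpu : p ∈ u := hp.resolve_right fun h => (hS p h).not_ge hpf
    have hqS : q ∈ S := hq.resolve_left fun h => hfu (u.mem_of_le hpu h hpf hqf)
    have upperLeft_p : c.UpperLeft p f :=
      ⟨hpf.lt_of_ne fun h => hfu (c.x_injective h ▸ hpu),
        lt_of_not_ge fun h => hfu (u.mem_of_le hpu hpu hpf h)⟩
    have upperLeft_q : c.UpperLeft f q :=
      ⟨hS q hqS, hqf.lt_of_ne fun h => hfS (c.y_injective h ▸ hqS)⟩
    obtain ⟨e, hef, hpe⟩ := exists_leftForces upperLeft_p upperLeft_q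
    obtain ⟨s, hs, hse⟩ := ih e hef.1.1 (fun h => hfT (hT hef h))
      ⟨⟨p, hp, hpe⟩, q, hq, hqf.trans hef.1.2.le⟩
    exact (hS s hs).not_ge (hse.trans hef.1.1.le)

theorem mem_hull_of_mem_hull_union [Finite E] (hT : T ∈ closedSets c.Forces)
    (hu : (u : Set E) \ T ⊆ S) (hfT : f ∉ T) (hf : f ∈ c.hull (u ∪ S)) : f ∈ c.hull S :=
  ⟨exists_x_le_of_mem_hull_union (fun _ _ h => hT (.inl h)) hu hfT hf,
    exists_x_le_of_mem_hull_union (c := c.swap) (u := swapOrderIso u) (fun _ _ h => hT (.inr h))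
      hu hfT hf.symm⟩

theorem inf_diff_subset [Finite E] (hT : T ∈ closedSets c.Forces) (hu : (u : Set E) \ T ⊆ v)
    (hw : (w : Set E) \ T ⊆ z) : ((u ⊓ w : c.Quadrant) : Set E) \ T ⊆ (v ⊓ z : c.Quadrant) := by
  rintro f ⟨hf, hfT⟩
  have mem_hull : f ∈ c.hull (u ∪ (w ∪ (v ∪ z))) := by
    refine hull_subset_iff.2 (subset_trans ?_ (subset_hull _)) hf
    exact Set.union_subset_union_right _ Set.subset_union_left
  have hu' : (u : Set E) \ T ⊆ w ∪ (v ∪ z) :=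
    hu.trans (Set.subset_union_left.trans Set.subset_union_right)
  exact mem_hull_of_mem_hull_union hT (hw.trans Set.subset_union_right) hfT
    (mem_hull_of_mem_hull_union hT hu' hfT mem_hull)

/-- The congruence that identifies quadrants differing only by points of a closed set. -/
def conOfClosed [Finite E] (T : closedSets c.Forces) : LatticeCon c.Quadrant where
  r u v := (u : Set E) \ T ⊆ v ∧ (v : Set E) \ T ⊆ u
  iseqv :=
    { refl := fun _ => ⟨Set.sdiff_subset, Set.sdiff_subset⟩
      symm := And.symm
      trans := fun h h' =>
        ⟨fun _ he => h'.1 ⟨h.1 he, he.2⟩, fun _ he => h.2 ⟨h'.2 he, he.2⟩⟩ }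
  sup h h' :=
    ⟨fun _ he => ⟨h.1 ⟨he.1.1, he.2⟩, h'.1 ⟨he.1.2, he.2⟩⟩,
      fun _ he => ⟨h.2 ⟨he.1.1, he.2⟩, h'.2 ⟨he.1.2, he.2⟩⟩⟩
  inf h h' := ⟨inf_diff_subset T.2 h.1 h'.1, inf_diff_subset T.2 h.2 h'.2⟩

theorem collapsed_conOfClosed [Finite E] (T : closedSets c.Forces) :
    collapsed (conOfClosed T) = T := by
  ext e
  refine ⟨fun h => by_contra fun he => ?_, fun he => ⟨?_, ?_⟩⟩
  · exact (h.1 ⟨⟨le_rfl, le_rfl⟩, he⟩ : e ∈ c.openQuad e).1.false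
  · exact fun f hf => mem_openQuad_of_mem_quad hf.1 fun hfe => hf.2 (hfe ▸ he)
  · exact fun f hf => quad_le_openQuad e hf.1

variable {θ θ' : LatticeCon c.Quadrant}

/-- Meeting `quad e` and `openQuad e` with the half-plane to the right of `t` separates `t`. -/
theorem mem_collapsed_of_leftForces (h : c.LeftForces e t) (he : e ∈ collapsed θ) :
    t ∈ collapsed θ := by
  obtain ⟨het, hmax, s, hts⟩ := h
  let halfPlane : c.Quadrant := c.rect (.Ioi (c.x t)) ⊥
  have mem_left : t ∈ c.quad e ⊓ halfPlane :=
    ⟨⟨e, .inl ⟨le_rfl, le_rfl⟩, het.1.le⟩, s, .inr ⟨hts.1, trivial⟩, hts.2.le⟩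
  have notMem_right : t ∉ c.openQuad e ⊓ halfPlane := by
    rintro ⟨⟨r, hr | hr, hrt⟩, -⟩
    · have hyr : c.y t < c.y r := het.2.trans hr.2
      have hxr : c.x r < c.x t := hrt.lt_of_ne fun h => hyr.ne (c.x_injective h ▸ rfl)
      exact (hmax r ⟨hxr, hyr⟩).not_gt hr.1
    · exact hrt.not_gt hr.1
  exact mem_collapsed_of_rel (θ.inf he (θ.iseqv.refl halfPlane)) mem_left notMem_right

theorem collapsed_swap : collapsed (latticeConComap swapOrderIso.symm θ) = collapsed θ := by
  have quad_swap (e : E) : swapOrderIso.symm (c.swap.quad e) = c.quad e :=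
    SetLike.ext fun _ => and_comm
  have openQuad_swap (e : E) : swapOrderIso.symm (c.swap.openQuad e) = c.openQuad e :=
    SetLike.ext fun _ => and_comm
  ext e
  change θ.r (swapOrderIso.symm (c.swap.quad e)) (swapOrderIso.symm (c.swap.openQuad e)) ↔ _
  rw [quad_swap, openQuad_swap]
  rfl

theorem collapsed_mem_closedSets : collapsed θ ∈ closedSets c.Forces := by
  rintro e t (h | h) he
  · exact mem_collapsed_of_leftForces h he
  · rw [← collapsed_swap] at he ⊢
    exact mem_collapsed_of_leftForces h he

theorem collapsed_subset_iff [Finite E] : collapsed θ ⊆ collapsed θ' ↔ θ ≤ θ' :=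
  ⟨fun h _ _ huv => rel_iff.2 fun e he => rel_iff.1 huv e fun he' => he (h he'),
    fun h _ he => h he⟩

/-- Congruences of the quadrant lattice correspond to closed sets of points. -/
def conOrderIso [Finite E] : LatticeCon c.Quadrant ≃o closedSets c.Forces where
  toFun θ := ⟨collapsed θ, collapsed_mem_closedSets⟩
  invFun := conOfClosed
  left_inv θ := by
    have : collapsed (conOfClosed ⟨collapsed θ, collapsed_mem_closedSets⟩) = collapsed θ :=
      collapsed_conOfClosed _
    exact le_antisymm (collapsed_subset_iff.1 this.le) (collapsed_subset_iff.1 this.ge)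
  right_inv T := Subtype.ext (collapsed_conOfClosed T)
  map_rel_iff' := collapsed_subset_iff

end Quadrant

end CongruencesAndClosedSets

/-! ### Quadrant lattices are slim semimodular -/

namespace Quadrant

variable {u : c.Quadrant}

theorem isUpperModularLattice : IsUpperModularLattice c.Quadrant where
  covBy_sup_of_inf_covBy {u v} h := by
    obtain ⟨e, heu, hinf⟩ := covBy_iff.1 h
    have subset_insert : (v : Set E) ⊆ insert e ↑u := hinf ▸ le_iff.1 inf_le_right
    have hev : e ∈ v := by
      by_contra hev
      refine h.ne (inf_eq_left.2 fun f hf => (subset_insert hf).resolve_left ?_)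
      exact fun hfe => hev (hfe ▸ hf)
    refine covBy_iff.2 ⟨e, fun he => heu he.1, Set.Subset.antisymm (fun f hf => ?_) ?_⟩
    · exact (subset_insert hf).imp_right fun hfu => ⟨hfu, hf⟩
    · exact Set.insert_subset hev fun f hf => hf.2

theorem exists_eq_rect_of_supIrred (hu : SupIrred u) :
    (∃ s, c.rect s ⊥ = u) ∨ ∃ t, c.rect ⊥ t = u := by
  have sup_eq : c.rect (upperClosure (c.x '' u)) ⊥ ⊔ c.rect ⊥ (upperClosure (c.y '' u)) = u := by
    refine SetLike.ext fun e => ⟨?_, fun he => ?_⟩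
    · rintro ⟨⟨⟨_, ⟨p, hp, rfl⟩, hpe⟩, -⟩, -, ⟨_, ⟨q, hq, rfl⟩, hqe⟩⟩
      exact u.mem_of_le hp hq hpe hqe
    · exact ⟨⟨⟨_, ⟨e, he, rfl⟩, le_rfl⟩, trivial⟩, trivial, ⟨_, ⟨e, he, rfl⟩, le_rfl⟩⟩
  exact (hu.2 sup_eq).imp (fun h => ⟨_, h⟩) fun h => ⟨_, h⟩

theorem isSlimSemimodularLattice [Finite E] : IsSlimSemimodularLattice c.Quadrant where
  finite := inferInstance
  nonempty := ⟨c.hull ∅⟩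
  semimodular := isUpperModularLattice
  jir_eq_union := by
    have isChain_left : IsChain (· ≤ ·) (Set.range fun s => c.rect s ⊥) :=
      Monotone.isChain_range fun s t h _ he => ⟨UpperSet.coe_subset_coe.2 h he.1, he.2⟩
    have isChain_right : IsChain (· ≤ ·) (Set.range fun t => c.rect ⊥ t) :=
      Monotone.isChain_range fun s t h _ he => ⟨he.1, UpperSet.coe_subset_coe.2 h he.2⟩
    refine ⟨{u | SupIrred u} ∩ Set.range fun s => c.rect s ⊥,
      {u | SupIrred u} ∩ Set.range fun t => c.rect ⊥ t, isChain_left.mono Set.inter_subset_right,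
      isChain_right.mono Set.inter_subset_right, ?_⟩
    rw [← Set.inter_union_distrib_left]
    exact (Set.inter_eq_left.2 fun u hu => exists_eq_rect_of_supIrred hu).symm

theorem infIrred_quad (e : E) : InfIrred (c.quad e) := by
  have he : e ∈ c.quad e := ⟨le_rfl, le_rfl⟩
  refine ⟨fun h => (h (quad_le_openQuad e) he).1.false, fun v w hvw => ?_⟩
  obtain ⟨⟨p, hp, hpe⟩, -⟩ : e ∈ v ⊓ w := hvw ▸ he
  have hpq : p ∈ c.quad e := hvw ▸ subset_hull _ hp
  obtain rfl : p = e := c.x_injective (hpe.antisymm hpq.1)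
  obtain hp | hp := hp
  · exact .inl ((le_quad_iff.2 hp).antisymm (hvw ▸ inf_le_left))
  · exact .inr ((le_quad_iff.2 hp).antisymm (hvw ▸ inf_le_right))

theorem exists_eq_quad_of_infIrred [Finite E] (hu : InfIrred u) : ∃ e, c.quad e = u := by
  have nonempty : (u : Set E).Nonempty := by
    by_contra! h
    exact hu.1 fun v _ => le_iff.2 (h ▸ Set.empty_subset _)
  obtain ⟨p, hp, hpmin⟩ := Set.exists_min_image u c.x (Set.toFinite _) nonempty
  obtain ⟨q, hq, hqmin⟩ := Set.exists_min_image u c.y (Set.toFinite _) nonempty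
  have inf_eq : c.quad p ⊓ c.quad q = u := by
    refine le_antisymm (fun f hf => ?_) (le_inf (le_quad_iff.2 hp) (le_quad_iff.2 hq))
    exact ⟨⟨p, .inl ⟨le_rfl, le_rfl⟩, hpmin f hf⟩, q, .inr ⟨le_rfl, le_rfl⟩, hqmin f hf⟩
  exact (hu.2 inf_eq).elim (fun h => ⟨p, h⟩) fun h => ⟨q, h⟩

theorem supIrred_rect_bot [Finite E] {s : UpperSet α} (hs : ∃ e, c.x e ∉ s)
    (h : ∀ e, c.x e ∉ s → ∃ b, c.x b ∈ s ∧ c.y b ≤ c.y e) : SupIrred (c.rect s ⊥) := by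
  obtain ⟨f, hf, hmax⟩ := Set.exists_max_image {e | c.x e ∉ s} c.x (Set.toFinite _) hs
  obtain ⟨b, hb, hbf⟩ := h f hf
  have mem_of_lt {v : c.Quadrant} (hv : v < c.rect s ⊥) : f ∈ v := by
    obtain ⟨p, hpv, hp⟩ := Set.exists_of_ssubset (lt_iff.1 hv)
    have hps : c.x p ∉ s := fun h => hp ⟨h, trivial⟩
    exact v.mem_of_le hpv (hv.le ⟨hb, trivial⟩) (hmax p hps) hbf
  refine ⟨fun hmin => ?_, fun v w hvw => ?_⟩
  · have : f ∈ c.rect s ⊥ := hmin (b := c.rect ⊥ ⊥) (fun e _ => ⟨trivial, trivial⟩)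
      ⟨trivial, trivial⟩
    exact hf this.1
  · by_contra! hne
    have hfv : f ∈ v := mem_of_lt ((hvw ▸ le_sup_left).lt_of_ne hne.1)
    have hfw : f ∈ w := mem_of_lt ((hvw ▸ le_sup_right).lt_of_ne hne.2)
    exact hf (hvw ▸ (⟨hfv, hfw⟩ : f ∈ v ⊔ w) : f ∈ c.rect s ⊥).1

theorem forall_le_or_forall_le_of_supIrred_quad (h : SupIrred (c.quad e)) :
    (∀ f, c.x e ≤ c.x f → c.y e ≤ c.y f) ∨ ∀ f, c.y e ≤ c.y f → c.x e ≤ c.x f := by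
  have sup_eq : c.rect (.Ici (c.x e)) ⊥ ⊔ c.rect ⊥ (.Ici (c.y e)) = c.quad e := by
    ext f
    exact ⟨fun hf => ⟨hf.1.1, hf.2.2⟩, fun hf => ⟨⟨hf.1, trivial⟩, trivial, hf.2⟩⟩
  refine (h.2 sup_eq).imp (fun h f hf => ?_) fun h f hf => ?_
  · exact (h ▸ (⟨hf, trivial⟩ : f ∈ c.rect (.Ici (c.x e)) ⊥) : f ∈ c.quad e).2
  · exact (h ▸ (⟨trivial, hf⟩ : f ∈ c.rect ⊥ (.Ici (c.y e))) : f ∈ c.quad e).1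

theorem coe_swap_quad : (c.swap.quad e : Set E) = c.quad e :=
  Set.ext fun _ => and_comm

theorem supIrred_swap_quad : SupIrred (c.swap.quad e) ↔ SupIrred (c.quad e) := by
  have swap_quad : swapOrderIso (c.quad e) = c.swap.quad e :=
    SetLike.coe_injective coe_swap_quad.symm
  rw [← swap_quad, supIrred_orderIso_apply]

end Quadrant

/-! ### Rectangular configurations -/

section Rectangular

variable {A B : Set E} {p s t : E}

/-- Two sets that split the boundary of a configuration: the points with no point to their upper
left, or no point to their lower right. Points with both properties may belong to either set. -/
structure IsBoundarySplit (c : PlanarConfig E α β) (A B : Set E) : Prop where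
  nonempty_left : A.Nonempty
  nonempty_right : B.Nonempty
  disjoint : Disjoint A B
  left : ∀ a ∈ A, ∀ p, ¬ c.UpperLeft p a
  right : ∀ b ∈ B, ∀ s, ¬ c.UpperLeft b s
  inner_left : ∀ e, e ∉ A → e ∉ B → ∃ p, c.UpperLeft p e
  inner_right : ∀ e, e ∉ A → e ∉ B → ∃ s, c.UpperLeft e s

/-- A boundary split in which the left boundary lies above, and the right boundary to the right of,
all other points. -/
structure IsRectangular (c : PlanarConfig E α β) (A B : Set E) : Prop
    extends c.IsBoundarySplit A B where
  above : ∀ a ∈ A, ∀ e ∉ A, c.y e < c.y a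
  beyond : ∀ b ∈ B, ∀ e ∉ B, c.x e < c.x b

theorem exists_isBoundarySplit [Finite E] [Nontrivial E] (c : PlanarConfig E α β) :
    ∃ A B, c.IsBoundarySplit A B := by
  obtain ⟨r, -, hr⟩ := Set.exists_max_image Set.univ c.x (Set.toFinite _) Set.univ_nonempty
  have not_upperLeft_r (s : E) : ¬ c.UpperLeft r s := fun h => (hr s trivial).not_gt h.1
  obtain ⟨a, har, ha⟩ := Set.exists_max_image {r}ᶜ c.y (Set.toFinite _) (exists_ne r)
  let A : Set E := {a | a ≠ r ∧ ∀ p, ¬ c.UpperLeft p a}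
  have notMem_r : r ∉ A := fun h => h.1 rfl
  refine ⟨A, {b | b ∉ A ∧ ∀ s, ¬ c.UpperLeft b s}, ⟨a, har, fun p hp => ?_⟩,
    ⟨r, notMem_r, not_upperLeft_r⟩, ?_, fun a ha => ha.2, fun b hb => hb.2, fun e heA heB => ?_,
    fun e heA heB => ?_⟩
  · exact (ha p fun hpr => not_upperLeft_r a (hpr ▸ hp)).not_gt hp.2
  · exact Set.disjoint_left.2 fun a ha ha' => ha'.1 ha
  · have her : e ≠ r := fun h => heB (h ▸ ⟨notMem_r, not_upperLeft_r⟩)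
    exact not_forall_not.1 fun h => heA ⟨her, h⟩
  · exact not_forall_not.1 fun h => heB ⟨heA, h⟩

namespace IsBoundarySplit

theorem swap (h : c.IsBoundarySplit A B) : c.swap.IsBoundarySplit B A where
  nonempty_left := h.nonempty_right
  nonempty_right := h.nonempty_left
  disjoint := h.disjoint.symm
  left b hb s hs := h.right b hb s (upperLeft_swap.1 hs)
  right a ha p hp := h.left a ha p (upperLeft_swap.1 hp)
  inner_left e hB hA := (h.inner_right e hA hB).imp fun _ => upperLeft_swap.2
  inner_right e hB hA := (h.inner_left e hA hB).imp fun _ => upperLeft_swap.2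

theorem exists_left_of_upperLeft [Finite E] (h : c.IsBoundarySplit A B) (hp : c.UpperLeft p e) :
    ∃ a ∈ A, c.UpperLeft a e := by
  obtain ⟨q, hq, hmax⟩ := Set.exists_max_image {q | c.UpperLeft q e} c.y (Set.toFinite _) ⟨p, hp⟩
  refine ⟨q, by_contra fun hqA => ?_, hq⟩
  obtain ⟨r, hr⟩ := h.inner_left q hqA fun hqB => h.right q hqB e hq
  exact (hmax r (hr.trans hq)).not_gt hr.2

end IsBoundarySplit

namespace IsRectangular

theorem swap (h : c.IsRectangular A B) : c.swap.IsRectangular B A where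
  toIsBoundarySplit := h.toIsBoundarySplit.swap
  above := h.beyond
  beyond := h.above

theorem exists_right_lt [Finite E] (h : c.IsRectangular A B) (he : e ∉ B) :
    ∃ b ∈ B, c.y b < c.y e := by
  by_cases heA : e ∈ A
  · obtain ⟨b, hb⟩ := h.nonempty_right
    exact ⟨b, hb, h.above e heA b (h.disjoint.notMem_of_mem_right hb)⟩
  · obtain ⟨s, hs⟩ := h.inner_right e heA he
    obtain ⟨b, hb, hbe⟩ := h.toIsBoundarySplit.swap.exists_left_of_upperLeft (upperLeft_swap.2 hs)
    exact ⟨b, hb, hbe.1⟩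

theorem exists_right_le [Finite E] (h : c.IsRectangular A B) (e : E) :
    ∃ b ∈ B, c.y b ≤ c.y e := by
  by_cases he : e ∈ B
  · exact ⟨e, he, le_rfl⟩
  · exact (h.exists_right_lt he).imp fun b hb => ⟨hb.1, hb.2.le⟩

theorem y_le_of_x_le (h : c.IsRectangular A B) (he : e ∈ B) (hxy : c.x e ≤ c.x f) :
    c.y e ≤ c.y f := by
  by_contra! hfe
  exact h.right e he f ⟨hxy.lt_of_ne fun h => hfe.ne (c.x_injective h ▸ rfl), hfe⟩

theorem mem_right_of_x_le (h : c.IsRectangular A B) (he : e ∈ B) (hxy : c.x e ≤ c.x f) : f ∈ B :=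
  by_contra fun hf => (h.beyond e he f hf).not_ge hxy

theorem exists_supIrred_quad_eq_right [Finite E] (h : c.IsRectangular A B) :
    ∃ b, SupIrred (c.quad b) ∧ (c.quad b : Set E) = B := by
  obtain ⟨b, hb, hmin⟩ := Set.exists_min_image B c.x (Set.toFinite _) h.nonempty_right
  have quad_eq : c.quad b = c.rect (.Ici (c.x b)) ⊥ := by
    ext f
    exact ⟨fun hf => ⟨hf.1, trivial⟩, fun hf => ⟨hf.1, h.y_le_of_x_le hb hf.1⟩⟩
  refine ⟨b, ?_, Set.Subset.antisymm ?_ ?_⟩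
  · obtain ⟨a, ha⟩ := h.nonempty_left
    have haB : a ∉ B := h.disjoint.notMem_of_mem_left ha
    rw [quad_eq]
    refine Quadrant.supIrred_rect_bot ⟨a, (h.beyond b hb a haB).not_ge⟩ fun e _ => ?_
    obtain ⟨d, hd, hde⟩ := h.exists_right_le e
    exact ⟨d, hmin d hd, hde⟩
  · exact fun f hf => h.mem_right_of_x_le hb hf.1
  · exact fun f hf => ⟨hmin f hf, h.y_le_of_x_le hb (hmin f hf)⟩

theorem coe_quad_eq_right [Finite E] (h : c.IsRectangular A B) (he : SupIrred (c.quad e))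
    (hle : ∀ f, c.x e ≤ c.x f → c.y e ≤ c.y f) : (c.quad e : Set E) = B := by
  have heB : e ∈ B := by
    by_contra heB
    obtain ⟨b, hb, hbe⟩ := h.exists_right_lt heB
    exact hbe.not_ge (hle b (h.beyond b hb e heB).le)
  obtain ⟨b, -, hb⟩ := h.exists_supIrred_quad_eq_right
  have sup_eq : c.quad b ⊔ c.rect ⊥ (.Ici (c.y e)) = c.quad e := by
    ext f
    refine ⟨fun hf => ⟨?_, hf.2.2⟩, fun hf => ⟨hb.ge ?_, trivial, hf.2⟩⟩
    · refine le_of_not_gt fun hlt => hlt.ne (congrArg c.x (c.y_injective ?_))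
      exact (h.y_le_of_x_le (hb.le hf.1) hlt.le).antisymm hf.2.2
    · exact h.mem_right_of_x_le heB hf.1
  refine (he.2 sup_eq).elim (fun h => h ▸ hb) fun heq => ?_
  obtain ⟨a, ha⟩ := h.nonempty_left
  have haB : a ∉ B := h.disjoint.notMem_of_mem_left ha
  have haU : a ∈ c.quad e :=
    heq ▸ ⟨trivial, (h.above a ha e (h.disjoint.notMem_of_mem_right heB)).le⟩
  exact absurd haU.1 (h.beyond e heB a haB).not_ge

theorem isSlimRectangularLattice [Finite E] (h : c.IsRectangular A B) :
    IsSlimRectangularLattice c.Quadrant where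
  toIsSlimSemimodularLattice := Quadrant.isSlimSemimodularLattice
  exists_corners := by
    obtain ⟨b, hb, hbB⟩ := h.exists_supIrred_quad_eq_right
    obtain ⟨a, ha, haA⟩ := h.swap.exists_supIrred_quad_eq_right
    rw [Quadrant.supIrred_swap_quad] at ha
    rw [Quadrant.coe_swap_quad] at haA
    have notMem_both {e : E} (hea : e ∈ c.quad a) (heb : e ∈ c.quad b) : False :=
      h.disjoint.ne_of_mem (haA.le hea) (hbB.le heb) rfl
    refine ⟨c.quad a, c.quad b, fun hab => ?_, fun u => ⟨fun hu => ?_, ?_⟩, fun v f _ => ?_,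
      fun v e he => (notMem_both he.1 he.2).elim⟩
    · exact notMem_both (e := b) (hab ▸ ⟨le_rfl, le_rfl⟩) ⟨le_rfl, le_rfl⟩
    · obtain ⟨e, rfl⟩ := Quadrant.exists_eq_quad_of_infIrred hu.2
      obtain hle | hle := Quadrant.forall_le_or_forall_le_of_supIrred_quad hu.1
      · exact .inr (SetLike.coe_injective ((h.coe_quad_eq_right hu.1 hle).trans hbB.symm))
      · have := h.swap.coe_quad_eq_right (Quadrant.supIrred_swap_quad.2 hu.1) hle
        rw [Quadrant.coe_swap_quad] at this
        exact .inl (SetLike.coe_injective (this.trans haA.symm))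
    · rintro (rfl | rfl)
      · exact ⟨ha, Quadrant.infIrred_quad a⟩
      · exact ⟨hb, Quadrant.infIrred_quad b⟩
    · obtain ⟨p, hp, hpf⟩ := h.swap.exists_right_le f
      obtain ⟨q, hq, hqf⟩ := h.exists_right_le f
      exact ⟨⟨p, .inl (haA.ge hp), hpf⟩, q, .inr (hbB.ge hq), hqf⟩

end IsRectangular

/-- The configuration obtained by pushing the points of `A` above all other points and those of `B`
to the right of all other points. Membership is the leading component of a coordinate. -/
noncomputable def raise (c : PlanarConfig E α β) (A B : Set E) :
    PlanarConfig E (Prop ×ₗ α) (Prop ×ₗ β) where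
  x e := toLex (e ∈ B, c.x e)
  y e := toLex (e ∈ A, c.y e)
  x_injective _ _ h := c.x_injective (congrArg (fun z => (ofLex z).2) h)
  y_injective _ _ h := c.y_injective (congrArg (fun z => (ofLex z).2) h)

omit [LinearOrder β] in
theorem raise_x_lt_iff :
    (c.raise A B).x e < (c.raise A B).x f ↔ e ∉ B ∧ f ∈ B ∨ (e ∈ B ↔ f ∈ B) ∧ c.x e < c.x f := by
  have prop_lt_iff : (e ∈ B) < (f ∈ B) ↔ e ∉ B ∧ f ∈ B := by
    simp only [lt_iff_le_not_ge, le_Prop_eq]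
    tauto
  exact Prod.Lex.toLex_lt_toLex.trans (or_congr prop_lt_iff (and_congr_left' eq_iff_iff))

omit [LinearOrder α] in
theorem raise_y_lt_iff :
    (c.raise A B).y e < (c.raise A B).y f ↔ e ∉ A ∧ f ∈ A ∨ (e ∈ A ↔ f ∈ A) ∧ c.y e < c.y f :=
  raise_x_lt_iff (c := c.swap) (A := B)

omit [LinearOrder β] in
theorem raise_x_le_iff (he : e ∉ B) (hf : f ∉ B) :
    (c.raise A B).x e ≤ (c.raise A B).x f ↔ c.x e ≤ c.x f := by
  rw [← not_lt, ← not_lt, raise_x_lt_iff]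
  tauto

theorem LeftForces.eq_of_leftForces (he : c.LeftForces e t) (hf : c.LeftForces f t) : e = f :=
  c.x_injective ((hf.2.1 e he.1).antisymm (he.2.1 f hf.1))

namespace IsBoundarySplit

theorem upperLeft_raise (h : c.IsBoundarySplit A B) (hp : c.UpperLeft p t) :
    (c.raise A B).UpperLeft p t := by
  have hpB : p ∉ B := fun hpB => h.right p hpB t hp
  have htA : t ∉ A := fun htA => h.left t htA p hp
  have := hp.1
  have := hp.2
  refine ⟨raise_x_lt_iff.2 ?_, raise_y_lt_iff.2 ?_⟩ <;> tauto

theorem not_upperLeft_raise (h : c.IsBoundarySplit A B) (ht : t ∈ A) :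
    ¬ (c.raise A B).UpperLeft p t := by
  rintro ⟨hx, hy⟩
  rw [raise_x_lt_iff] at hx
  rw [raise_y_lt_iff] at hy
  have htB : t ∉ B := h.disjoint.notMem_of_mem_left ht
  exact h.left t ht p ⟨by tauto, by tauto⟩

theorem isRectangular_raise (h : c.IsBoundarySplit A B) : (c.raise A B).IsRectangular A B where
  nonempty_left := h.nonempty_left
  nonempty_right := h.nonempty_right
  disjoint := h.disjoint
  left _ ha _ := h.not_upperLeft_raise ha
  right _ hb _ hs := h.swap.not_upperLeft_raise hb (upperLeft_swap.2 hs)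
  inner_left e hA hB := (h.inner_left e hA hB).imp fun _ => h.upperLeft_raise
  inner_right e hA hB := (h.inner_right e hA hB).imp fun _ => h.upperLeft_raise
  above _ ha _ he := raise_y_lt_iff.2 (.inl ⟨he, ha⟩)
  beyond _ hb _ he := raise_x_lt_iff.2 (.inl ⟨he, hb⟩)

theorem leftForces_raise (h : c.IsBoundarySplit A B) (he : c.LeftForces e t) :
    (c.raise A B).LeftForces e t := by
  obtain ⟨het, hmax, s, hts⟩ := he
  have heB : e ∉ B := fun heB => h.right e heB t het
  have htB : t ∉ B := fun htB => h.right t htB s hts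
  refine ⟨h.upperLeft_raise het, fun f hf => ?_, s, h.upperLeft_raise hts⟩
  have hfB : f ∉ B := fun hfB => h.isRectangular_raise.right f hfB t hf
  rw [raise_x_le_iff hfB heB]
  by_contra! hef
  have hx : c.x f < c.x t := by
    have := raise_x_lt_iff.1 hf.1
    tauto
  have hy : c.y f ≤ c.y t := not_lt.1 fun hy => (hmax f ⟨hx, hy⟩).not_gt hef
  have hfA : f ∈ A := by
    have := raise_y_lt_iff.1 hf.2
    have := hy.not_gt
    tauto
  exact h.left f hfA e ⟨hef, hy.trans_lt het.2⟩

/-- By uniqueness of left-forcing points it suffices that `t` has a left-forcing point in `c`, that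
is, that `t` does not lie on the boundary. -/
theorem leftForces_raise_iff [Finite E] (h : c.IsBoundarySplit A B) :
    (c.raise A B).LeftForces e t ↔ c.LeftForces e t := by
  refine ⟨fun he => ?_, h.leftForces_raise⟩
  obtain ⟨het, -, s, hts⟩ := id he
  have htA : t ∉ A := fun htA => h.isRectangular_raise.left t htA e het
  have htB : t ∉ B := fun htB => h.isRectangular_raise.right t htB s hts
  obtain ⟨p, hp⟩ := h.inner_left t htA htB
  obtain ⟨q, hq⟩ := h.inner_right t htA htB
  obtain ⟨f, hf, -⟩ := exists_leftForces hp hq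
  rwa [he.eq_of_leftForces (h.leftForces_raise hf)]

theorem forces_raise [Finite E] (h : c.IsBoundarySplit A B) : (c.raise A B).Forces = c.Forces := by
  ext e t
  exact or_congr h.leftForces_raise_iff h.swap.leftForces_raise_iff

end IsBoundarySplit

end Rectangular

/-! ### Restriction to the complement of a closed set -/

section Restriction

variable {T : Set E}

/-- The subconfiguration formed by the points of `S`. -/
def restrict (c : PlanarConfig E α β) (S : Set E) : PlanarConfig S α β where
  x := c.x ∘ (↑)
  y := c.y ∘ (↑)
  x_injective := c.x_injective.comp Subtype.val_injective
  y_injective := c.y_injective.comp Subtype.val_injective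

theorem leftForces_restrict [Finite E] (hT : T ∈ closedSets c.Forces) {e t : ↥Tᶜ}
    (h : c.LeftForces e t) : (c.restrict Tᶜ).LeftForces e t := by
  obtain ⟨het, hmax, s, hts⟩ := h
  obtain ⟨f, hf, -⟩ := exists_leftForces (c := c.swap) (upperLeft_swap.2 hts) (upperLeft_swap.2 het)
  have hfT : f ∉ T := fun hfT => t.2 (hT (.inr hf) hfT)
  exact ⟨het, fun p hp => hmax p hp, ⟨f, hfT⟩, upperLeft_swap.1 hf.1⟩

/-- As with `leftForces_raise_iff`, uniqueness of left-forcing points gives the converse. -/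
theorem leftForces_restrict_iff [Finite E] (hT : T ∈ closedSets c.Forces) {e t : ↥Tᶜ} :
    (c.restrict Tᶜ).LeftForces e t ↔ c.LeftForces e t := by
  refine ⟨fun he => ?_, leftForces_restrict hT⟩
  obtain ⟨het, -, s, hts⟩ := id he
  obtain ⟨f, hf, -⟩ : ∃ f, c.LeftForces f t ∧ c.x e ≤ c.x f := exists_leftForces het hts
  have hfT : f ∉ T := fun hfT => t.2 (hT (.inl hf) hfT)
  rwa [he.eq_of_leftForces (leftForces_restrict hT (e := ⟨f, hfT⟩) hf)]

theorem forces_restrict_iff [Finite E] (hT : T ∈ closedSets c.Forces) {e t : ↥Tᶜ} :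
    (c.restrict Tᶜ).Forces e t ↔ c.Forces e t :=
  or_congr (leftForces_restrict_iff hT)
    (leftForces_restrict_iff (c := c.swap) fun _ _ h => hT h.symm)

end Restriction

end PlanarConfig

end PlanarConfigurations

/-! ### Slim semimodular lattices are quadrant lattices -/

section IrreducibleDecomposition

variable {L : Type*} [Lattice L] [Finite L] {a b : L}

theorem exists_supIrred_le_not_le (h : ¬ a ≤ b) : ∃ j, SupIrred j ∧ j ≤ a ∧ ¬ j ≤ b := by
  have : Nonempty L := ⟨a⟩
  let := Fintype.ofFinite L
  let := Fintype.toBoundedOrder L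
  obtain ⟨s, rfl, hs⟩ := exists_supIrred_decomposition a
  simp only [Finset.sup_le_iff, id_eq, not_forall] at h
  obtain ⟨j, hj, hjb⟩ := h
  exact ⟨j, hs hj, Finset.le_sup (f := id) hj, hjb⟩

theorem exists_infIrred_le_not_le (h : ¬ a ≤ b) : ∃ m, InfIrred m ∧ b ≤ m ∧ ¬ a ≤ m := by
  obtain ⟨m, hm, hbm, ham⟩ := exists_supIrred_le_not_le (L := Lᵒᵈ) (a := OrderDual.toDual b)
    (b := OrderDual.toDual a) h
  exact ⟨OrderDual.ofDual m, infIrred_ofDual.2 hm, hbm, ham⟩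

theorem exists_isGLB_of_finite [Nonempty L] (S : Set L) : ∃ a, IsGLB S a := by
  let := Fintype.ofFinite L
  let := Fintype.toBoundedOrder L
  have isGLB_inf := Finset.isGLB_inf_id (s := (Set.toFinite S).toFinset)
  rw [(Set.toFinite S).coe_toFinset] at isGLB_inf
  exact ⟨_, isGLB_inf⟩

end IrreducibleDecomposition

section Covers

variable {L : Type*} [Lattice L] {c d m n p q r z : L}

theorem le_of_infIrred_of_covBy_of_lt (hm : InfIrred m) (hmd : m ⋖ d) (hmn : m < n) : d ≤ n := by
  by_contra hdn
  have inf_eq : d ⊓ n = m := (hmd.eq_or_eq (le_inf hmd.le hmn.le) inf_le_left).resolve_right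
    fun h => hdn (inf_eq_left.1 h)
  exact (hm.2 inf_eq).elim hmd.ne' hmn.ne'

theorem covBy_sup_of_covBy_of_le [IsUpperModularLattice L] (hcd : c ⋖ d) (hcz : c ≤ z)
    (hdz : ¬ d ≤ z) : z ⋖ d ⊔ z := by
  have inf_eq : d ⊓ z = c := (hcd.eq_or_eq (le_inf hcd.le hcz) inf_le_left).resolve_right
    fun h => hdz (inf_eq_left.1 h)
  exact IsUpperModularLattice.covBy_sup_of_inf_covBy (by rwa [inf_eq])

theorem eq_of_covBy_of_isChain {C : Set L} (hC : IsChain (· ≤ ·) C) (hp : z ⋖ p) (hq : z ⋖ q)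
    (hCp : ∃ i ∈ C, i ≤ p ∧ ¬ i ≤ z) (hCq : ∃ j ∈ C, j ≤ q ∧ ¬ j ≤ z) : p = q := by
  obtain ⟨i, hi, hip, hiz⟩ := hCp
  obtain ⟨j, hj, hjq, hjz⟩ := hCq
  by_contra hpq
  have inf_eq : p ⊓ q = z := hp.wcovBy.inf_eq hq.wcovBy hpq
  obtain hij | hji := hC.total hi hj
  · exact hiz (inf_eq ▸ le_inf hip (hij.trans hjq))
  · exact hjz (inf_eq ▸ le_inf (hji.trans hip) hjq)

theorem IsSlimLattice.eq_of_covBy (hL : IsSlimLattice L) (hp : z ⋖ p) (hq : z ⋖ q) (hr : z ⋖ r)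
    (hpq : p ≠ q) (hpr : p ≠ r) : q = r := by
  have := hL.finite
  obtain ⟨C, C', hC, hC', hJ⟩ := hL.jir_eq_union
  have exists_mem {a : L} (ha : z ⋖ a) :
      (∃ i ∈ C, i ≤ a ∧ ¬ i ≤ z) ∨ ∃ i ∈ C', i ≤ a ∧ ¬ i ≤ z := by
    obtain ⟨i, hi, hia, hiz⟩ := exists_supIrred_le_not_le ha.lt.not_ge
    exact (hJ.le hi).imp (fun h => ⟨i, h, hia, hiz⟩) fun h => ⟨i, h, hia, hiz⟩
  obtain hCp | hCp := exists_mem hp <;> obtain hCq | hCq := exists_mem hq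
  · exact absurd (eq_of_covBy_of_isChain hC hp hq hCp hCq) hpq
  · obtain hCr | hCr := exists_mem hr
    · exact absurd (eq_of_covBy_of_isChain hC hp hr hCp hCr) hpr
    · exact eq_of_covBy_of_isChain hC' hq hr hCq hCr
  · obtain hCr | hCr := exists_mem hr
    · exact eq_of_covBy_of_isChain hC hq hr hCq hCr
    · exact absurd (eq_of_covBy_of_isChain hC' hp hr hCp hCr) hpr
  · exact absurd (eq_of_covBy_of_isChain hC' hp hq hCp hCq) hpq

/-- Otherwise the covers of `m ⊓ n` below `m` and below `n` and the cover `d ⊔ m ⊓ n` would be three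
distinct covers of `m ⊓ n`. -/
theorem IsSlimSemimodularLattice.le_or_le_of_covBy (hL : IsSlimSemimodularLattice L) (hcd : c ⋖ d)
    (hcm : c ≤ m) (hcn : c ≤ n) (hdm : ¬ d ≤ m) (hdn : ¬ d ≤ n) : m ≤ n ∨ n ≤ m := by
  have := hL.finite
  have := hL.semimodular
  by_contra! ⟨hmn, hnm⟩
  obtain ⟨p, hp, hpm⟩ := exists_covBy_le_of_lt (inf_lt_left.2 hmn)
  obtain ⟨q, hq, hqn⟩ := exists_covBy_le_of_lt (inf_lt_right.2 hnm)
  have hr : m ⊓ n ⋖ d ⊔ m ⊓ n := covBy_sup_of_covBy_of_le hcd (le_inf hcm hcn)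
    fun h => hdm (h.trans inf_le_left)
  have hpq : p ≠ q := fun h => hp.lt.not_ge (le_inf hpm (h ▸ hqn))
  have hpr : p ≠ d ⊔ m ⊓ n := fun h => hdm (le_sup_left.trans (h ▸ hpm))
  have hqr : q ≠ d ⊔ m ⊓ n := fun h => hdn (le_sup_left.trans (h ▸ hqn))
  exact hqr (hL.eq_of_covBy hp hq hr hpq hpr)

end Covers

section FlagCoordinates

variable {L : Type*} [Lattice L] {s t : Flag L} {m n : L}

theorem covBy_of_flag_covBy {a b : s} (h : a ⋖ b) : (a : L) ⋖ b := by
  refine ⟨h.lt, fun z haz hzb => ?_⟩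
  have hz : z ∈ s := by
    refine Flag.mem_iff_forall_le_or_ge.2 fun y hy => ?_
    obtain hya | hay := s.le_or_le hy a.2
    · exact .inr (hya.trans haz.le)
    · obtain hyb | hby := s.le_or_le hy b.2
      · obtain hya | hyb := h.wcovBy.eq_or_eq (c := ⟨y, hy⟩) hay hyb
        · exact .inr ((Subtype.ext_iff.1 hya).trans_le haz.le)
        · exact .inl (hzb.le.trans_eq (Subtype.ext_iff.1 hyb).symm)
      · exact .inl (hzb.le.trans hby)
  exact h.2 (c := ⟨z, hz⟩) haz hzb

theorem exists_isLeast_flag_not_le [Finite L] (s : Flag L) (hm : ¬ IsMax m) :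
    ∃ d, IsLeast {c | c ∈ s ∧ ¬ c ≤ m} d := by
  have : Nonempty L := ⟨m⟩
  let := Fintype.ofFinite L
  let := Fintype.toBoundedOrder L
  have top_mem : ⊤ ∈ {c | c ∈ s ∧ ¬ c ≤ m} := ⟨s.top_mem, fun h => hm (top_le_iff.1 h ▸ isMax_top)⟩
  obtain ⟨d, hd, hmin⟩ := (Set.toFinite {c | c ∈ s ∧ ¬ c ≤ m}).exists_minimal ⟨⊤, top_mem⟩
  exact ⟨d, hd, fun c hc => (s.le_or_le hd.1 hc.1).elim id (hmin hc)⟩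

theorem exists_flag_covBy [Finite L] (s : Flag L) (hm : ¬ IsMax m) :
    ∃ c ∈ s, ∃ d ∈ s, c ⋖ d ∧ c ≤ m ∧ ¬ d ≤ m := by
  have : Nonempty L := ⟨m⟩
  let := Fintype.ofFinite L
  let := Fintype.toBoundedOrder L
  obtain ⟨d, ⟨hd, hdm⟩, hmin⟩ := exists_isLeast_flag_not_le s hm
  have bot_lt : (⊥ : s) < ⟨d, hd⟩ := bot_lt_iff_ne_bot.2 fun h =>
    hdm ((Subtype.ext_iff.1 h).trans_le bot_le)
  obtain ⟨c, -, hcd⟩ := exists_le_covBy_of_lt bot_lt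
  refine ⟨c, c.2, d, hd, covBy_of_flag_covBy hcd, ?_, hdm⟩
  exact by_contra fun hcm => hcd.lt.not_ge (hmin ⟨c.2, hcm⟩)

/-- The position of `m` relative to the maximal chain `s`: the members of `s` below `m`. -/
def flagCoord (s : Flag L) (m : L) : LowerSet s where
  carrier := {c | (c : L) ≤ m}
  lower' _ _ h := (Subtype.coe_le_coe.2 h).trans

theorem flagCoord_le_iff : flagCoord s m ≤ flagCoord s n ↔ ∀ c ∈ s, c ≤ m → c ≤ n :=
  ⟨fun h c hc hcm => h (a := ⟨c, hc⟩) hcm, fun h c => h c c.2⟩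

theorem IsSlimSemimodularLattice.flagCoord_injective (hL : IsSlimSemimodularLattice L)
    (s : Flag L) : Function.Injective fun m : {m : L // InfIrred m} => flagCoord s m := by
  have := hL.finite
  have := hL.semimodular
  rintro ⟨m, hm⟩ ⟨n, hn⟩ (hmn : flagCoord s m = flagCoord s n)
  obtain ⟨c, hc, d, hd, hcd, hcm, hdm⟩ := exists_flag_covBy s hm.1
  have hcn : c ≤ n := flagCoord_le_iff.1 hmn.le c hc hcm
  have hdn : ¬ d ≤ n := fun h => hdm (flagCoord_le_iff.1 hmn.ge d hd h)
  have not_lt {a b : L} (ha : InfIrred a) (hca : c ≤ a) (hda : ¬ d ≤ a) (hdb : ¬ d ≤ b) :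
      ¬ a < b := fun hab => hdb <| le_sup_left.trans <|
    le_of_infIrred_of_covBy_of_lt ha (covBy_sup_of_covBy_of_le hcd hca hda) hab
  refine Subtype.ext ?_
  obtain hle | hle := hL.le_or_le_of_covBy hcd hcm hcn hdm hdn
  · exact hle.eq_of_not_lt (not_lt hm hcm hdm hdn)
  · exact (hle.eq_of_not_lt (not_lt hn hcn hdn hdm)).symm

theorem exists_flagCoord_le_of_isGLB [Finite L] {K : Set L} {a : L} (s : Flag L) (hK : IsGLB K a)
    (hm : ¬ IsMax m) (ham : a ≤ m) : ∃ k ∈ K, flagCoord s k ≤ flagCoord s m := by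
  by_contra! h
  obtain ⟨d, ⟨-, hdm⟩, hmin⟩ := exists_isLeast_flag_not_le s hm
  refine hdm (((le_isGLB_iff hK).2 fun k hk => ?_).trans ham)
  obtain ⟨c, hc, hck, hcm⟩ : ∃ c ∈ s, c ≤ k ∧ ¬ c ≤ m := by
    simpa only [flagCoord_le_iff, not_forall, exists_prop] using h k hk
  exact (hmin ⟨hc, hcm⟩).trans hck

/-- The meet-irreducible elements of a slim semimodular lattice, placed in the plane by their
positions relative to two maximal chains. -/
noncomputable def IsSlimSemimodularLattice.planarConfig (hL : IsSlimSemimodularLattice L)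
    (s t : Flag L) : PlanarConfig {m : L // InfIrred m} (LowerSet s) (LowerSet t) where
  x m := flagCoord s m
  y m := flagCoord t m
  x_injective := hL.flagCoord_injective s
  y_injective := hL.flagCoord_injective t

namespace IsSlimSemimodularLattice

variable (hL : IsSlimSemimodularLattice L) (hst : ∀ j : L, SupIrred j → j ∈ s ∨ j ∈ t)

open scoped Classical in
/-- The quadrant of the meet-irreducible elements above `a`. -/
noncomputable def quadrantAbove (a : L) : (hL.planarConfig s t).Quadrant where
  carrier := {m | a ≤ m}
  mem_of_le' p q m hp hq hx hy := by
    have := hL.finite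
    by_contra ham
    obtain ⟨j, hj, hja, hjm⟩ := exists_supIrred_le_not_le ham
    obtain hjs | hjt := hst j hj
    · exact hjm (flagCoord_le_iff.1 hx j hjs (hja.trans hp))
    · exact hjm (flagCoord_le_iff.1 hy j hjt (hja.trans hq))

open scoped Classical in
theorem quadrantAbove_le_iff {a b : L} :
    hL.quadrantAbove hst a ≤ hL.quadrantAbove hst b ↔ a ≤ b := by
  have := hL.finite
  refine ⟨fun h => by_contra fun hab => ?_, fun h m => h.trans⟩
  obtain ⟨m, hm, hbm, ham⟩ := exists_infIrred_le_not_le hab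
  exact ham (h (a := ⟨m, hm⟩) hbm)

open scoped Classical in
theorem quadrantAbove_surjective : Function.Surjective (hL.quadrantAbove hst) := by
  intro u
  have := hL.finite
  have := hL.nonempty
  obtain ⟨a, ha⟩ := exists_isGLB_of_finite (Subtype.val '' (u : Set {m : L // InfIrred m}))
  refine ⟨a, SetLike.ext fun m => ⟨fun ham => ?_, fun hm => ha.1 ⟨m, hm, rfl⟩⟩⟩
  obtain ⟨_, ⟨p, hp, rfl⟩, hpm⟩ := exists_flagCoord_le_of_isGLB s ha m.2.1 ham
  obtain ⟨_, ⟨q, hq, rfl⟩, hqm⟩ := exists_flagCoord_le_of_isGLB t ha m.2.1 ham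
  exact u.mem_of_le hp hq hpm hqm

open scoped Classical in
/-- A slim semimodular lattice is the quadrant lattice of its meet-irreducible elements, placed in
the plane by two maximal chains that contain all join-irreducible elements. -/
noncomputable def orderIsoQuadrant : L ≃o (hL.planarConfig s t).Quadrant :=
  RelIso.ofSurjective (OrderEmbedding.ofMapLEIff _ fun _ _ => hL.quadrantAbove_le_iff hst)
    (hL.quadrantAbove_surjective hst)

end IsSlimSemimodularLattice

theorem IsSlimLattice.exists_flag_supIrred (hL : IsSlimLattice L) :
    ∃ s t : Flag L, ∀ j, SupIrred j → j ∈ s ∨ j ∈ t := by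
  obtain ⟨C, C', hC, hC', hJ⟩ := hL.jir_eq_union
  obtain ⟨s, hs⟩ := hC.exists_subset_flag
  obtain ⟨t, ht⟩ := hC'.exists_subset_flag
  exact ⟨s, t, fun j hj => (hJ.le hj).imp (@hs j) (@ht j)⟩

end FlagCoordinates

/-! ### Filters of the lattice of closed sets -/

section ClosedSets

variable {E : Type*} {R : E → E → Prop}

/-- The closed sets that contain `T` correspond to the closed sets of its complement. -/
def closedSetsIciOrderIso (T : closedSets R) {R' : ↥(T : Set E)ᶜ → ↥(T : Set E)ᶜ → Prop}
    (hR : ∀ {e t}, R' e t ↔ R e t) : Set.Ici T ≃o closedSets R' where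
  toFun U := ⟨{e | ↑e ∈ U.1.1}, fun _ _ h he => U.1.2 (hR.1 h) he⟩
  invFun S := ⟨⟨{e : E | ∀ h : e ∉ T.1, ⟨e, h⟩ ∈ S.1},
    fun e t het he ht => S.2 (e := ⟨e, fun he => ht (T.2 het he)⟩) (hR.2 het) (he _)⟩,
    fun _ he h => (h he).elim⟩
  left_inv U := by
    ext e
    exact ⟨fun h => by_contra fun he => he (h fun heT => he (U.2 heT)), fun he _ => he⟩
  right_inv S := by
    ext e
    exact ⟨fun h => h e.2, fun h _ => h⟩
  map_rel_iff' {U V} := by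
    refine ⟨fun h e he => by_contra fun heV => ?_, fun h _ he => h he⟩
    exact heV (h (a := ⟨e, fun heT => heV (V.2 heT)⟩) he)

theorem nontrivial_of_two_lt_card_closedSets (h : 2 < Nat.card (closedSets R)) : Nontrivial E := by
  by_contra hE
  rw [not_nontrivial_iff_subsingleton] at hE
  have card_le : Nat.card E ≤ 1 := Finite.card_le_one_iff_subsingleton.2 hE
  have := calc
    Nat.card (closedSets R) ≤ Nat.card (Set E) :=
      Nat.card_le_card_of_injective _ Subtype.val_injective
    _ = 2 ^ Nat.card E := by
      rw [Set, Nat.card_fun, Nat.card_eq_fintype_card, Fintype.card_prop]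
    _ ≤ 2 ^ 1 := Nat.pow_le_pow_right two_pos card_le
  omega

end ClosedSets

/-! ### Representable distributive lattices -/

theorem IsSlimSemimodularLattice.exists_conOrderIso.{u} {L : Type u} [Lattice L]
    (hL : IsSlimSemimodularLattice L) :
    ∃ (α β : Type u) (_ : LinearOrder α) (_ : LinearOrder β)
      (c : PlanarConfig {m : L // InfIrred m} α β),
      Nonempty (LatticeCon L ≃o closedSets c.Forces) := by
  classical
  have := hL.finite
  obtain ⟨s, t, hst⟩ := hL.exists_flag_supIrred
  exact ⟨_, _, inferInstance, inferInstance, hL.planarConfig s t,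
    ⟨(latticeConCongr (hL.orderIsoQuadrant hst)).trans PlanarConfig.Quadrant.conOrderIso⟩⟩

section Representability

variable {D D' : Type*} [DistribLattice D] [DistribLattice D']

section PlanarConfig

variable {E : Type} [Finite E] {α β : Type*} [LinearOrder α] [LinearOrder β]
  {c : PlanarConfig E α β}

theorem CSPSRepresentable.of_orderIso_closedSets (f : D ≃o closedSets c.Forces) :
    CSPSRepresentable D :=
  ⟨c.Quadrant, inferInstance, PlanarConfig.Quadrant.isSlimSemimodularLattice,
    ⟨f.trans PlanarConfig.Quadrant.conOrderIso.symm⟩⟩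

theorem CSRRepresentable.of_orderIso_closedSets (f : D ≃o closedSets c.Forces)
    (hD : 2 < Nat.card D) : CSRRepresentable D := by
  have := nontrivial_of_two_lt_card_closedSets (Nat.card_congr f.toEquiv ▸ hD)
  obtain ⟨A, B, h⟩ := c.exists_isBoundarySplit
  rw [← h.forces_raise] at f
  exact ⟨(c.raise A B).Quadrant, inferInstance, h.isRectangular_raise.isSlimRectangularLattice,
    ⟨f.trans PlanarConfig.Quadrant.conOrderIso.symm⟩⟩

end PlanarConfig

theorem CSPSRepresentable.of_orderIso_ici (hD : CSPSRepresentable D) {d : D}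
    (f : D' ≃o Set.Ici d) : CSPSRepresentable D' ∧ (2 < Nat.card D' → CSRRepresentable D') := by
  obtain ⟨L, _, hL, ⟨g⟩⟩ := hD
  have := hL.finite
  obtain ⟨α, β, _, _, c, ⟨k⟩⟩ := hL.exists_conOrderIso
  let T : closedSets c.Forces := g.trans k d
  let f' : D' ≃o closedSets (c.restrict (T : Set _)ᶜ).Forces :=
    (f.trans ((g.trans k).Ici d)).trans
      (closedSetsIciOrderIso T (PlanarConfig.forces_restrict_iff T.2))
  exact ⟨.of_orderIso_closedSets f', .of_orderIso_closedSets f'⟩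

theorem exists_orderIso_ici_pfilter [Finite D] (F : Order.PFilter D) :
    ∃ d : D, Nonempty (F ≃o Set.Ici d) := by
  obtain ⟨d, hd, hmin⟩ := (Set.toFinite (F : Set D)).exists_minimal F.nonempty
  have coe_eq_ici : (F : Set D) = Set.Ici d := Set.ext fun a =>
    ⟨fun ha => (hmin (Order.PFilter.inf_mem hd ha) inf_le_left).trans inf_le_right,
      fun ha => Order.PFilter.mem_of_le ha hd⟩
  exact ⟨d, ⟨OrderIso.setCongr _ _ coe_eq_ici⟩⟩

end Representability

/-! ### Representable posets -/

section Birkhoff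

/-- Isomorphic lattices have isomorphic posets of join-irreducible elements. -/
def jirPosetCongr {L L' : Type*} [Lattice L] [Lattice L'] (f : L ≃o L') :
    JirPoset L ≃o JirPoset L' where
  toEquiv := f.toEquiv.subtypeEquiv fun _ => (supIrred_orderIso_apply f).symm
  map_rel_iff' := f.map_rel_iff

variable {P : Type*} [PartialOrder P]

theorem nonempty_orderIso_jirPoset_iff [Finite P] {D : Type*} [DistribLattice D] [Nonempty D]
    [Finite D] : Nonempty (P ≃o JirPoset D) ↔ Nonempty (LowerSet P ≃o D) := by
  classical
  have := Fintype.ofFinite D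
  let := Fintype.toOrderBot D
  exact ⟨fun ⟨f⟩ => ⟨(LowerSet.map f).trans OrderIso.lowerSetSupIrred.symm⟩,
    fun ⟨f⟩ => ⟨OrderIso.supIrredLowerSet.trans (jirPosetCongr f)⟩⟩

theorem IsSlimSemimodularLattice.nonempty_orderIso_jirPoset_con_iff [Finite P] {L : Type*}
    [Lattice L] (hL : IsSlimSemimodularLattice L) :
    Nonempty (P ≃o JirPoset (LatticeCon L)) ↔ Nonempty (LowerSet P ≃o LatticeCon L) := by
  have := hL.finite
  obtain ⟨α, β, _, _, c, ⟨k⟩⟩ := hL.exists_conOrderIso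
  have : Nonempty (closedSets c.Forces) := ⟨k ⊥⟩
  exact ⟨fun ⟨f⟩ => (nonempty_orderIso_jirPoset_iff.1 ⟨f.trans (jirPosetCongr k)⟩).map
      fun g => g.trans k.symm,
    fun ⟨f⟩ => (nonempty_orderIso_jirPoset_iff.2 ⟨f.trans k⟩).map
      fun g => g.trans (jirPosetCongr k.symm)⟩

theorem jcspsRepresentable_iff [Finite P] : JCSPSRepresentable P ↔ CSPSRepresentable (LowerSet P) :=
  exists_congr fun _ => exists_congr fun _ => and_congr_right fun hL =>
    hL.nonempty_orderIso_jirPoset_con_iff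

theorem jcsrRepresentable_iff [Finite P] : JCSRRepresentable P ↔ CSRRepresentable (LowerSet P) :=
  exists_congr fun _ => exists_congr fun _ => and_congr_right fun hL =>
    hL.nonempty_orderIso_jirPoset_con_iff

theorem JCSRRepresentable.jcspsRepresentable (hP : JCSRRepresentable P) : JCSPSRepresentable P :=
  hP.imp fun _ => .imp fun _ => .imp_left (·.toIsSlimSemimodularLattice)

/-- The lower sets of an upper set `F` correspond to the lower sets that contain its complement. -/
def lowerSetOrderIsoIciCompl (F : UpperSet P) : LowerSet F ≃o Set.Ici F.compl where
  toFun S := ⟨⟨{p | ∀ h : p ∈ F, ⟨p, h⟩ ∈ S}, fun p q hqp hp hq =>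
    S.lower (a := ⟨p, F.upper hqp hq⟩) hqp (hp _)⟩, fun _ hp h => (hp h).elim⟩
  invFun T := ⟨{p | ↑p ∈ (T : LowerSet P)}, fun _ _ hqp hp => T.1.lower hqp hp⟩
  left_inv S := by
    ext p
    exact ⟨fun h => h p.2, fun h _ => h⟩
  right_inv T := by
    ext p
    exact ⟨fun h => by_contra fun hp => hp (h (by_contra fun hpF => hp (T.2 hpF))), fun h _ => h⟩
  map_rel_iff' {S T} := ⟨fun h p hp => h (a := p) (fun _ => hp) p.2, fun h _ hp hF => h (hp hF)⟩

theorem card_lt_card_lowerSet (P : Type*) [PartialOrder P] [Finite P] :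
    Nat.card P < Nat.card (LowerSet P) := by
  rw [Nat.card_congr (OrderIso.supIrredLowerSet (α := P)).toEquiv]
  exact Finite.card_subtype_lt not_supIrred_bot

theorem JCSPSRepresentable.upperSet [Finite P] (hP : JCSPSRepresentable P) (F : UpperSet P) :
    JCSPSRepresentable F ∧ (2 ≤ Nat.card F → JCSRRepresentable F) := by
  rw [jcspsRepresentable_iff, jcsrRepresentable_iff]
  exact ((jcspsRepresentable_iff.1 hP).of_orderIso_ici (lowerSetOrderIsoIciCompl F)).imp_right
    fun h hF => h (hF.trans_lt (card_lt_card_lowerSet F))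

end Birkhoff

theorem mainTheorem5 :
    (∀ (D : Type*) [DistribLattice D] [Finite D], CSPSRepresentable D →
      ∀ F : Order.PFilter D,
        CSPSRepresentable F ∧ (3 ≤ Nat.card F → CSRRepresentable F)) ∧
    (∀ (P : Type*) [PartialOrder P] [Finite P],
      (JCSPSRepresentable P → ∀ F : UpperSet P,
        JCSPSRepresentable F ∧ (2 ≤ Nat.card F → JCSRRepresentable F)) ∧
      (JCSRRepresentable P → ∀ F : UpperSet P,
        2 ≤ Nat.card F → JCSRRepresentable F)) := by
  refine ⟨fun D _ _ hD F => ?_, fun P _ _ =>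
    ⟨fun hP F => hP.upperSet F, fun hP F => (hP.jcspsRepresentable.upperSet F).2⟩⟩
  obtain ⟨d, ⟨f⟩⟩ := exists_orderIso_ici_pfilter F
  exact hD.of_orderIso_ici f
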